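/- Theorem. For a finite simple graph $G$ let $\chi'(G)$ be its chromatic index, i.e. the least $k$ such that the edges of $G$ can be coloured with $k$ colours so that any two distinct edges sharing an endpoint receive different colours. Let $vs_{\chi'}(G)$ be the minimum number of vertices of $G$ whose removal results in a graph $H$ with $\chi'(H)\ne\chi'(G)$ (and $vs_{\chi'}(G)=0$ if $G$ has no edges). Let $p\ge 3$, let $a_1,\dots,a_p$ be positive integers, and let $G=K_{a_1,\dots,a_p}$ be the complete multipartite graph with parts of sizes $a_1,\dots,a_p$ (two vertices are adjacent if and only if they lie in different parts). Then $$1\le vs_{\chi'}(G)\le 3.$$ -/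

import Mathlib

namespace EdgeStability

/-- A labelling of the edges by `k` colours is proper if any two distinct edges that share an
endpoint get different colours. -/
def IsProperEdgeColoring {V : Type*} (G : SimpleGraph V) (k : ℕ) (c : G.edgeSet → Fin k) : Prop :=
  ∀ e₁ e₂ : G.edgeSet, e₁ ≠ e₂ → (∃ v : V, v ∈ (e₁ : Sym2 V) ∧ v ∈ (e₂ : Sym2 V)) → c e₁ ≠ c e₂

/-- `G` is `k`-edge colourable. -/
def EdgeColorable {V : Type*} (G : SimpleGraph V) (k : ℕ) : Prop :=
  ∃ c : G.edgeSet → Fin k, IsProperEdgeColoring G k c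

/-- The chromatic index of a finite graph: the least `k` for which it is `k`-edge colourable. -/
noncomputable def chromaticIndex {V : Type*} [Finite V] (G : SimpleGraph V) : ℕ :=
  sInf {k : ℕ | EdgeColorable G k}

/-- The infimum in `chromaticIndex` is attained: every finite graph is edge colourable. -/
theorem edgeColorable_chromaticIndex {V : Type*} [Finite V] (G : SimpleGraph V) :
    EdgeColorable G (chromaticIndex G) := by
  have h : {k : ℕ | EdgeColorable G k}.Nonempty := by
    obtain ⟨n, ⟨f⟩⟩ := Finite.exists_equiv_fin G.edgeSet
    exact ⟨n, f, fun e₁ e₂ hne _ heq => hne (f.injective heq)⟩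
  exact Nat.sInf_mem h

open Classical in
/-- The edge chromatic vertex stability number of a finite graph `G`: the least number of vertices
whose removal changes the chromatic index, and `0` if `G` has no edge. -/
noncomputable def vertexStability {V : Type*} [Finite V] (G : SimpleGraph V) : ℕ :=
  if G.edgeSet = ∅ then 0
  else sInf {k : ℕ | ∃ S : Finset V, S.card = k ∧
    chromaticIndex (G.induce {v : V | v ∉ S}) ≠ chromaticIndex G}

/-- The infimum in `vertexStability` is attained when `G` has an edge. -/
theorem exists_card_eq_vertexStability {V : Type*} [Finite V] (G : SimpleGraph V)
    (hG : G.edgeSet ≠ ∅) :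
    ∃ S : Finset V, S.card = vertexStability G ∧
      chromaticIndex (G.induce {v : V | v ∉ S}) ≠ chromaticIndex G := by
  have h : {k : ℕ | ∃ S : Finset V, S.card = k ∧
      chromaticIndex (G.induce {v : V | v ∉ S}) ≠ chromaticIndex G}.Nonempty := by
    have := Fintype.ofFinite V
    refine ⟨_, Finset.univ, rfl, ?_⟩
    have h0 : chromaticIndex (G.induce {v : V | v ∉ (Finset.univ : Finset V)}) = 0 := by
      have hV : IsEmpty {v : V | v ∉ (Finset.univ : Finset V)} := ⟨fun v => v.2 (Finset.mem_univ _)⟩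
      refine Nat.sInf_eq_zero.2 (Or.inl ?_)
      have hE : IsEmpty (G.induce {v : V | v ∉ (Finset.univ : Finset V)}).edgeSet := by
        refine ⟨fun e => ?_⟩
        obtain ⟨e, _⟩ := e
        induction e with | _ a b => exact hV.elim a
      exact ⟨fun e => hE.elim e, fun e => hE.elim e⟩
    obtain ⟨c, _⟩ := edgeColorable_chromaticIndex G
    obtain ⟨e, he⟩ := Set.nonempty_iff_ne_empty.2 hG
    have := (c ⟨e, he⟩).isLt
    omega
  unfold vertexStability
  rw [if_neg hG]
  exact Nat.sInf_mem h

end EdgeStability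

/-!
A complete multipartite graph with at least three parts contains a triangle `S` with one vertex in
each of three different parts. Every vertex lies in at most one of these parts, so every vertex
outside `S` has at least two neighbours in `S`. Hence deleting `S` lowers the degree of each
remaining vertex by at least two, to at most `Δ - 2`, where `Δ` is the maximum degree of `G`. By
Vizing's theorem the remaining graph has chromatic index at most `(Δ - 2) + 1`, which is less than
`Δ ≤ χ'(G)` (`chromaticIndex_induce_lt`). So three vertices suffice. Deleting no vertex changes
nothing, which gives the lower bound.

Most of the work is Vizing's theorem (`exists_isProperOn_of_degree_le`). The proof adds the vertices
one at a time, in the style of Ehrenfeucht, Faber and Kierstead, and uses Kempe exchanges but no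
fans. Let `v` be the new vertex, `N` the set of its neighbours already present, and `K` the set of
colours, `|N| ≤ |K|`. Each `u ∈ N` reserves a set `F u` of colours missing at `u`, with `|F u| = 2`
except for one vertex where `|F u| = 1`. If some colour `i` is reserved by exactly one `u`, give the
edge `vu` the colour `i` and continue with `N` without `u` and `K` without `i`: no other vertex has
reserved `i`, so all other reservations stay valid (`IsReserve.exists_isProperOn`). If no such colour
exists, `∑ |F u| = 2 |N| - 1 < 2 |K|` is odd, so some colour `i` is reserved by nobody and some
colour `j` at least three times. A component of the subgraph of colours `i` and `j` is a path or a
cycle, so at most two of its vertices miss `j` (`card_misses_le_two`). Exchanging `i` and `j` on the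
component of a vertex that reserves `j` thus makes `i` reserved while `j` stays reserved, so fewer
colours remain unreserved (`IsReserve.exists_unique_color`).
-/

namespace EdgeStability

variable {V α : Type*}

/-! ### Proper colourings and Kempe exchanges -/

/-- The restriction of `c` to the edges of `G` is a proper edge colouring. The colouring is a total
function on `Sym2 V`, whose values off the edges of `G` are irrelevant; this lets the coloured graph
vary while the type of colourings stays fixed. -/
def IsProperOn (G : SimpleGraph V) (c : Sym2 V → α) : Prop :=
  ∀ x y z, G.Adj x y → G.Adj x z → c s(x, y) = c s(x, z) → y = z

/-- The colour `i` appears on no edge of `G` at `x`. -/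
def Misses (G : SimpleGraph V) (c : Sym2 V → α) (x : V) (i : α) : Prop :=
  ∀ y, G.Adj x y → c s(x, y) ≠ i

/-- The subgraph of `G` formed by the edges coloured `i` or `j`. -/
def kempeGraph (G : SimpleGraph V) (c : Sym2 V → α) (i j : α) : SimpleGraph V where
  Adj x y := G.Adj x y ∧ (c s(x, y) = i ∨ c s(x, y) = j)
  symm := ⟨fun x y h => by rwa [G.adj_comm, Sym2.eq_swap]⟩
  loopless := ⟨fun x h => G.loopless.irrefl x h.1⟩

open Classical in
/-- The colouring obtained from `c` by exchanging the colours `i` and `j` on all edges that meet `C`.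
It is meant for a set `C` closed under adjacency in `kempeGraph G c i j`, for which an edge of `G`
whose colour changes has both ends in `C`. -/
noncomputable def kempeSwap (c : Sym2 V → α) (i j : α) (C : Set V) : Sym2 V → α :=
  fun e => if ∃ x ∈ e, x ∈ C then Equiv.swap i j (c e) else c e

section Kempe

variable {G : SimpleGraph V} {c : Sym2 V → α} {i j : α} {C : Set V}

open Classical in
theorem kempeSwap_of_adj (hC : ∀ x y, (kempeGraph G c i j).Adj x y → x ∈ C → y ∈ C) {x y : V}
    (h : G.Adj x y) :
    kempeSwap c i j C s(x, y) = if x ∈ C then Equiv.swap i j (c s(x, y)) else c s(x, y) := by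
  by_cases hx : x ∈ C
  · rw [if_pos hx, kempeSwap, if_pos ⟨x, Sym2.mem_mk_left x y, hx⟩]
  rw [if_neg hx, kempeSwap]
  split_ifs with h'
  · obtain ⟨z, hz, hzC⟩ := h'
    obtain rfl | rfl := Sym2.mem_iff.1 hz
    · exact absurd hzC hx
    · have hn : ¬ (kempeGraph G c i j).Adj x z := fun hk => hx (hC z x hk.symm hzC)
      exact Equiv.swap_apply_of_ne_of_ne (fun he => hn ⟨h, Or.inl he⟩)
        (fun he => hn ⟨h, Or.inr he⟩)
  · rfl

open Classical in
theorem IsProperOn.kempeSwap (hc : IsProperOn G c)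
    (hC : ∀ x y, (kempeGraph G c i j).Adj x y → x ∈ C → y ∈ C) :
    IsProperOn G (kempeSwap c i j C) := by
  intro x y z hy hz h
  rw [kempeSwap_of_adj hC hy, kempeSwap_of_adj hC hz] at h
  split_ifs at h
  · exact hc x y z hy hz ((Equiv.swap i j).injective h)
  · exact hc x y z hy hz h

open Classical in
theorem Misses.kempeSwap_of_mem {x : V} {l : α} (h : Misses G c x l)
    (hC : ∀ x y, (kempeGraph G c i j).Adj x y → x ∈ C → y ∈ C) (hx : x ∈ C) :
    Misses G (kempeSwap c i j C) x (Equiv.swap i j l) := by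
  intro y hy he
  rw [kempeSwap_of_adj hC hy, if_pos hx] at he
  exact h y hy ((Equiv.swap i j).injective he)

open Classical in
theorem Misses.kempeSwap_of_notMem {x : V} {l : α} (h : Misses G c x l)
    (hC : ∀ x y, (kempeGraph G c i j).Adj x y → x ∈ C → y ∈ C) (hx : x ∉ C) :
    Misses G (kempeSwap c i j C) x l := by
  intro y hy he
  rw [kempeSwap_of_adj hC hy, if_neg hx] at he
  exact h y hy he

open Classical in
/-- A component of the subgraph of two colours has at most two vertices that miss a given one of
the colours. The component is connected with all degrees at most `2`, and degree at most `1` where a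
colour is missing; a connected graph on `n` vertices has degree sum at least `2 (n - 1)`. -/
theorem card_misses_le_two [Fintype V] (hc : IsProperOn G c)
    (C : (kempeGraph G c i j).ConnectedComponent) (S : Finset V)
    (hS : ∀ x ∈ S, x ∈ C.supp ∧ Misses G c x j) : S.card ≤ 2 := by
  let H := (kempeGraph G c i j).induce C.supp
  have hconn : H.Connected := C.connected_toSimpleGraph
  have hadj : ∀ x y : C.supp, H.Adj x y → (kempeGraph G c i j).Adj x y :=
    fun x y h => h
  have hdeg : ∀ x : C.supp, H.degree x + (if (x : V) ∈ S then 1 else 0) ≤ 2 := by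
    intro x
    have key : ∀ T : Finset α, (∀ y : C.supp, H.Adj x y → c s((x : V), (y : V)) ∈ T) →
        H.degree x ≤ T.card := by
      intro T hT
      rw [← SimpleGraph.card_neighborFinset_eq_degree]
      refine Finset.card_le_card_of_injOn (fun y => c s((x : V), (y : V)))
        (fun y hy => hT y (by simpa using hy)) ?_
      intro y hy z hz h
      exact Subtype.ext (hc x y z (hadj x y (by simpa using hy)).1
        (hadj x z (by simpa using hz)).1 h)
    split_ifs with hx
    · have := key {i} fun y hy => by
        have h := hadj x y hy
        simpa using h.2.resolve_right ((hS x hx).2 y h.1)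
      simpa using this
    · refine (key {i, j} fun y hy => ?_).trans Finset.card_le_two
      simpa using (hadj x y hy).2
  have hsum := Finset.sum_le_sum fun x (_ : x ∈ (Finset.univ : Finset C.supp)) => hdeg x
  rw [Finset.sum_add_distrib, SimpleGraph.sum_degrees_eq_twice_card_edges] at hsum
  have hScard : ∑ x : C.supp, (if (x : V) ∈ S then 1 else 0) = S.card := by
    rw [← Finset.card_filter]
    refine Finset.card_bij (fun x _ => (x : V)) (fun x hx => by simpa using hx)
      (fun x _ y _ h => Subtype.ext h) fun x hx => ⟨⟨x, (hS x hx).1⟩, by simpa using hx, rfl⟩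
  have hle := hconn.card_vert_le_card_edgeSet_add_one
  rw [Nat.card_eq_fintype_card, Nat.card_eq_fintype_card, ← SimpleGraph.edgeFinset_card] at hle
  rw [hScard] at hsum
  simp only [Finset.sum_const, Finset.card_univ, smul_eq_mul] at hsum
  omega

end Kempe

/-! ### Reserved colours and Vizing's theorem -/

/-- The state while the edges from `v` to `N` are being coloured: `c` is a proper colouring of `G`,
no colour of the palette `K` appears at `v`, and each `u ∈ N` has a reserve `F u ⊆ K` of colours
missing at `u`. The reserve need not contain all the missing colours. -/
structure IsReserve (G : SimpleGraph V) (c : Sym2 V → α) (v : V) (N : Finset V) (K : Finset α)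
    (F : V → Finset α) : Prop where
  proper : IsProperOn G c
  misses_center : ∀ i ∈ K, Misses G c v i
  subset : ∀ u ∈ N, F u ⊆ K
  misses : ∀ u ∈ N, ∀ i ∈ F u, Misses G c u i

open Classical in
/-- If the sum of the sizes of the reserves is odd and less than `2 |K|`, then Kempe exchanges lead
to reserves of the same sizes in which some colour is reserved by exactly one vertex of `N`. Each
exchange lowers the number of colours of `K` that nobody has reserved. -/
theorem IsReserve.exists_unique_color [Fintype V] {G : SimpleGraph V} {c : Sym2 V → α} {v : V}
    {N : Finset V} {K : Finset α} {F : V → Finset α} (h : IsReserve G c v N K F)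
    (hlt : ∑ u ∈ N, (F u).card < 2 * K.card) (hodd : Odd (∑ u ∈ N, (F u).card)) :
    ∃ (c' : Sym2 V → α) (F' : V → Finset α), IsReserve G c' v N K F' ∧
      (∀ u ∈ N, (F' u).card = (F u).card) ∧
      ∃ i ∈ K, (N.filter fun u => i ∈ F' u).card = 1 := by
  induction hm : (K.filter fun i => (N.filter fun u => i ∈ F u) = ∅).card using
    Nat.strong_induction_on generalizing c F with
  | _ m ih =>
  by_cases h1 : ∃ i ∈ K, (N.filter fun u => i ∈ F u).card = 1
  · exact ⟨c, F, h, fun _ _ => rfl, h1⟩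
  push Not at h1
  have hsum : ∑ i ∈ K, (N.filter fun u => i ∈ F u).card = ∑ u ∈ N, (F u).card := by
    simp only [Finset.card_filter]
    rw [Finset.sum_comm]
    refine Finset.sum_congr rfl fun u hu => ?_
    rw [← Finset.card_filter, Finset.filter_mem_eq_inter, Finset.inter_eq_right.2 (h.subset u hu)]
  -- on average, a colour is reserved less than twice
  obtain ⟨i, hiK, hi⟩ : ∃ i ∈ K, (N.filter fun u => i ∈ F u).card < 2 := by
    by_contra! hcon
    have := Finset.sum_le_sum hcon
    simp only [Finset.sum_const, smul_eq_mul] at this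
    omega
  have hi0 : (N.filter fun u => i ∈ F u) = ∅ := by
    have := h1 i hiK
    exact Finset.card_eq_zero.1 (by omega)
  -- if every colour were reserved `0` or `2` times, the sum would be even
  obtain ⟨j, hjK, hj⟩ : ∃ j ∈ K, 3 ≤ (N.filter fun u => j ∈ F u).card := by
    by_contra! hcon
    rw [← hsum] at hodd
    refine Nat.not_even_iff_odd.2 hodd (Finset.even_sum _ fun l hl => ?_)
    have h1' := h1 l hl
    have h3 := hcon l hl
    interval_cases (N.filter fun u => l ∈ F u).card <;> simp_all
  obtain ⟨w, hw⟩ : (N.filter fun u => j ∈ F u).Nonempty := Finset.card_pos.1 (by omega)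
  set C := (kempeGraph G c i j).connectedComponentMk w
  have hC : ∀ x y, (kempeGraph G c i j).Adj x y → x ∈ C.supp → y ∈ C.supp := fun x y hxy hx =>
    C.mem_supp_of_adj_mem_supp hx hxy
  have hi0' : ∀ u ∈ N, i ∉ F u := fun u hu => by
    simpa using (Finset.filter_eq_empty_iff.1 hi0) hu
  have hcard2 : ((N.filter fun u => j ∈ F u).filter fun u => u ∈ C.supp).card ≤ 2 := by
    refine card_misses_le_two h.proper C _ fun x hx => ?_
    simp only [Finset.mem_filter] at hx
    exact ⟨hx.2, h.misses x hx.1.1 j hx.1.2⟩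
  have hwC : w ∈ C.supp := rfl
  -- a vertex that keeps `j` in its reserve after the exchange
  obtain ⟨w', hw', hw'C⟩ : ∃ w' ∈ N.filter fun u => j ∈ F u, w' ∉ C.supp := by
    by_contra! hcon
    rw [Finset.filter_true_of_mem hcon] at hcard2
    omega
  rw [Finset.mem_filter] at hw hw'
  set c' := kempeSwap c i j C.supp
  set F' : V → Finset α := fun u =>
    if u ∈ C.supp then (F u).map (Equiv.swap i j).toEmbedding else F u with hF'
  have hF'in : ∀ u ∈ C.supp, F' u = (F u).map (Equiv.swap i j).toEmbedding := fun u hu => if_pos hu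
  have hF'out : ∀ u ∉ C.supp, F' u = F u := fun u hu => if_neg hu
  have hswapK : ∀ l ∈ K, Equiv.swap i j l ∈ K := fun l hl => by
    rw [Equiv.swap_apply_def]; split_ifs <;> assumption
  have hcardF : ∀ u, (F' u).card = (F u).card := fun u => by
    simp only [hF']; split_ifs <;> simp
  have hres : IsReserve G c' v N K F' := by
    refine ⟨h.proper.kempeSwap hC, fun l hl => ?_, fun u hu => ?_, fun u hu l hl => ?_⟩
    · by_cases hv : v ∈ C.supp
      · have := (h.misses_center _ (hswapK l hl)).kempeSwap_of_mem hC hv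
        rwa [Equiv.swap_apply_self] at this
      · exact (h.misses_center l hl).kempeSwap_of_notMem hC hv
    · by_cases huC : u ∈ C.supp
      · rw [hF'in u huC]
        intro l hl
        obtain ⟨l', hl', rfl⟩ := Finset.mem_map.1 hl
        exact hswapK l' (h.subset u hu hl')
      · rw [hF'out u huC]
        exact h.subset u hu
    · by_cases huC : u ∈ C.supp
      · rw [hF'in u huC] at hl
        obtain ⟨l', hl', rfl⟩ := Finset.mem_map.1 hl
        exact (h.misses u hu l' hl').kempeSwap_of_mem hC huC
      · rw [hF'out u huC] at hl
        exact (h.misses u hu l hl).kempeSwap_of_notMem hC huC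
  obtain ⟨c'', F'', hr, hcard, hone⟩ := ih _ (by
    rw [← hm]
    refine Finset.card_lt_card (Finset.ssubset_iff_of_subset ?_ |>.2 ⟨i, ?_, ?_⟩)
    · intro l hl
      simp only [Finset.mem_filter, Finset.filter_eq_empty_iff] at hl ⊢
      refine ⟨hl.1, fun u hu hlu => ?_⟩
      have hli : l ≠ i := fun hli => hi0' u hu (hli ▸ hlu)
      by_cases hlj : l = j
      · exact hl.2 hw'.1 (by rw [hF'out w' hw'C, hlj]; exact hw'.2)
      · refine hl.2 hu ?_
        by_cases huC : u ∈ C.supp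
        · rw [hF'in u huC]
          exact Finset.mem_map.2 ⟨l, hlu, Equiv.swap_apply_of_ne_of_ne hli hlj⟩
        · rwa [hF'out u huC]
    · exact Finset.mem_filter.2 ⟨hiK, hi0⟩
    · intro hmem
      refine (Finset.filter_eq_empty_iff.1 (Finset.mem_filter.1 hmem).2) hw.1 ?_
      rw [hF'in w hwC]
      exact Finset.mem_map.2 ⟨j, hw.2, Equiv.swap_apply_right i j⟩)
    hres (by simpa only [hcardF] using hlt) (by simpa only [hcardF] using hodd) rfl
  exact ⟨c'', F'', hr, fun u hu => (hcard u hu).trans (hcardF u), hone⟩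

open Classical in
/-- If `|N| ≤ |K|` and every vertex of `N` has at least two colours in reserve, except for one vertex
`w` that may have only one, then the colouring can be modified and extended to the edges from `v` to
`N`. The exception is needed for the parity argument, and survives the removal of a vertex from
`N`. -/
theorem IsReserve.exists_isProperOn [Fintype V] {G G' : SimpleGraph V} {c : Sym2 V → α} {v : V}
    {N : Finset V} {K : Finset α} {F : V → Finset α} (h : IsReserve G c v N K F)
    (hle : N.card ≤ K.card) (w : V) (hF₁ : ∀ u ∈ N, 1 ≤ (F u).card)
    (hF₂ : ∀ u ∈ N, u ≠ w → 2 ≤ (F u).card)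
    (hG' : G' ≤ G ⊔ SimpleGraph.fromRel fun x y => x = v ∧ y ∈ N) :
    ∃ c' : Sym2 V → α, IsProperOn G' c' := by
  induction hn : N.card generalizing G c N K F w with
  | zero =>
    obtain rfl := Finset.card_eq_zero.1 hn
    refine ⟨c, fun x y z hy hz => h.proper x y z ?_ ?_⟩
    · simpa using hG' hy
    · simpa using hG' hz
  | succ n ih =>
  -- the exceptional vertex may be taken in `N`, and the reserves shrunk to exactly `1` and `2` colours
  obtain ⟨w, hwN, hF₂⟩ : ∃ w ∈ N, ∀ u ∈ N, u ≠ w → 2 ≤ (F u).card := by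
    by_cases hw : w ∈ N
    · exact ⟨w, hw, hF₂⟩
    · obtain ⟨w', hw'⟩ := Finset.card_pos.1 (by omega : 0 < N.card)
      exact ⟨w', hw', fun u hu _ => hF₂ u hu fun huw => hw (huw ▸ hu)⟩
  have hex : ∀ u : V, ∃ T : Finset α, u ∈ N → T ⊆ F u ∧ T.card = if u = w then 1 else 2 := by
    intro u
    by_cases hu : u ∈ N
    · obtain ⟨T, hT⟩ := Finset.exists_subset_card_eq (s := F u) (n := if u = w then 1 else 2) (by
        split_ifs with huw
        · exact hF₁ u hu
        · exact hF₂ u hu huw)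
      exact ⟨T, fun _ => hT⟩
    · exact ⟨∅, fun h => absurd h hu⟩
  choose T hT using hex
  have hTres : IsReserve G c v N K T := ⟨h.proper, h.misses_center,
    fun u hu => (hT u hu).1.trans (h.subset u hu),
    fun u hu i hi => h.misses u hu i ((hT u hu).1 hi)⟩
  have hsum : ∑ u ∈ N, (T u).card + 1 = 2 * N.card := by
    rw [Finset.sum_congr rfl fun u hu => (hT u hu).2, ← Finset.add_sum_erase N _ hwN,
      Finset.sum_congr rfl fun u hu => if_neg (Finset.ne_of_mem_erase hu)]
    simp only [if_true, Finset.sum_const, smul_eq_mul, Finset.card_erase_of_mem hwN]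
    omega
  obtain ⟨c₁, F₁, h₁, hcard, i, hiK, hi⟩ := hTres.exists_unique_color (by omega)
    ⟨N.card - 1, by omega⟩
  obtain ⟨u, hu⟩ := Finset.card_eq_one.1 hi
  have huN : u ∈ N ∧ i ∈ F₁ u :=
    Finset.mem_filter.1 (hu ▸ Finset.mem_singleton_self u : u ∈ N.filter fun u => i ∈ F₁ u)
  have huniq : ∀ x ∈ N, i ∈ F₁ x → x = u := fun x hx hxi => by
    rw [← Finset.mem_singleton, ← hu]; exact Finset.mem_filter.2 ⟨hx, hxi⟩
  -- colour the edge `vu` with the colour `i` that only `u` has reserved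
  set G₁ : SimpleGraph V := G ⊔ SimpleGraph.edge v u with hG₁
  set c₂ := Function.update c₁ s(v, u) i with hc₂
  have hc₂self : c₂ s(v, u) = i := Function.update_self _ _ _
  have hc₂ne : ∀ e, e ≠ s(v, u) → c₂ e = c₁ e := fun e he => Function.update_of_ne he _ _
  have hadj : ∀ x y, G₁.Adj x y → s(x, y) ≠ s(v, u) → G.Adj x y := by
    intro x y hxy hne
    simp only [hG₁, SimpleGraph.sup_adj, SimpleGraph.edge_adj] at hxy
    simp only [ne_eq, Sym2.eq_iff] at hne
    tauto
  have hi_end : ∀ x, x = v ∨ x = u → Misses G c₁ x i := by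
    rintro x (rfl | rfl)
    · exact h₁.misses_center i hiK
    · exact h₁.misses x huN.1 i huN.2
  have hproper : IsProperOn G₁ c₂ := by
    intro x y z hy hz he
    by_cases hyu : s(x, y) = s(v, u) <;> by_cases hzu : s(x, z) = s(v, u)
    · exact Sym2.congr_right.1 (hyu.trans hzu.symm)
    · rw [hyu, hc₂self, hc₂ne _ hzu] at he
      exact absurd he.symm (hi_end x (Sym2.mem_iff.1 (hyu ▸ Sym2.mem_mk_left x y)) z
        (hadj _ _ hz hzu))
    · rw [hzu, hc₂self, hc₂ne _ hyu] at he
      exact absurd he (hi_end x (Sym2.mem_iff.1 (hzu ▸ Sym2.mem_mk_left x z)) y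
        (hadj _ _ hy hyu))
    · rw [hc₂ne _ hyu, hc₂ne _ hzu] at he
      exact h₁.proper x y z (hadj _ _ hy hyu) (hadj _ _ hz hzu) he
  have hmiss : ∀ x l, l ≠ i → Misses G c₁ x l → Misses G₁ c₂ x l := by
    intro x l hl hx y hy he
    by_cases hyu : s(x, y) = s(v, u)
    · rw [hyu, hc₂self] at he; exact hl he.symm
    · rw [hc₂ne _ hyu] at he
      exact hx y (hadj _ _ hy hyu) he
  have hFi : ∀ x ∈ N.erase u, i ∉ F₁ x := fun x hx hxi =>
    Finset.ne_of_mem_erase hx (huniq x (Finset.mem_of_mem_erase hx) hxi)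
  have hFcard : ∀ x ∈ N.erase u, (F₁ x).card = if x = w then 1 else 2 := fun x hx =>
    (hcard x (Finset.mem_of_mem_erase hx)).trans (hT x (Finset.mem_of_mem_erase hx)).2
  refine ih (G := G₁) (c := c₂) (N := N.erase u) (K := K.erase i) (F := F₁) ?_ ?_ w ?_ ?_ ?_ ?_
  · refine ⟨hproper, fun l hl => hmiss v l (Finset.ne_of_mem_erase hl)
      (h₁.misses_center l (Finset.mem_of_mem_erase hl)), fun x hx l hl => ?_, fun x hx l hl => ?_⟩
    · exact Finset.mem_erase.2 ⟨fun hli => hFi x hx (hli ▸ hl),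
        h₁.subset x (Finset.mem_of_mem_erase hx) hl⟩
    · exact hmiss x l (fun hli => hFi x hx (hli ▸ hl))
        (h₁.misses x (Finset.mem_of_mem_erase hx) l hl)
  · rw [Finset.card_erase_of_mem huN.1, Finset.card_erase_of_mem hiK]
    omega
  · intro x hx
    rw [hFcard x hx]
    split_ifs <;> omega
  · intro x hx hxw
    rw [hFcard x hx, if_neg hxw]
  · intro x y hxy
    have := hG' hxy
    simp only [hG₁, SimpleGraph.sup_adj, SimpleGraph.edge_adj, SimpleGraph.fromRel_adj,
      Finset.mem_erase] at this ⊢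
    by_cases hx : x = u <;> by_cases hy : y = u <;> tauto
  · rw [Finset.card_erase_of_mem huN.1]; omega

open Classical in
/-- **Vizing's theorem**: a finite simple graph with all degrees at most `d` has a proper edge
colouring with `d + 1` colours. -/
theorem exists_isProperOn_of_degree_le [Fintype V] (G : SimpleGraph V) (d : ℕ)
    (hd : ∀ x, G.degree x ≤ d) : ∃ c : Sym2 V → Fin (d + 1), IsProperOn G c := by
  suffices H : ∀ S : Finset V, ∃ c : Sym2 V → Fin (d + 1),
      IsProperOn (G ⊓ SimpleGraph.fromRel fun x y => x ∈ S ∧ y ∈ S) c by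
    obtain ⟨c, hc⟩ := H Finset.univ
    refine ⟨c, fun x y z hy hz => hc x y z ?_ ?_⟩
    · simpa using ⟨hy, hy.ne⟩
    · simpa using ⟨hz, hz.ne⟩
  intro S
  induction S using Finset.induction_on with
  | empty => exact ⟨fun _ => 0, fun x y z hy => by simp at hy⟩
  | insert v S hv ih =>
  obtain ⟨c, hc⟩ := ih
  set G₀ := G ⊓ SimpleGraph.fromRel fun x y => x ∈ S ∧ y ∈ S with hG₀
  have hadj : ∀ x y, G₀.Adj x y ↔ G.Adj x y ∧ x ∈ S ∧ y ∈ S := by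
    intro x y
    simp only [hG₀, SimpleGraph.inf_adj, SimpleGraph.fromRel_adj]
    have := fun h : G.Adj x y => h.ne
    tauto
  set N := (G.neighborFinset v).filter fun u => u ∈ S with hN
  set F : V → Finset (Fin (d + 1)) := fun u =>
    Finset.univ \ (G₀.neighborFinset u).image fun y => c s(u, y) with hF
  have hres : IsReserve G₀ c v N Finset.univ F := by
    refine ⟨hc, fun i _ y hy => absurd ((hadj v y).1 hy).2.1 hv, fun u _ => Finset.subset_univ _,
      fun u _ i hi y hy he => ?_⟩
    refine (Finset.mem_sdiff.1 hi).2 (Finset.mem_image.2 ⟨y, ?_, he⟩)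
    rwa [SimpleGraph.mem_neighborFinset]
  -- the edge `uv` is not yet coloured, so at most `d - 1` of the `d + 1` colours appear at `u`
  have hFcard : ∀ u ∈ N, 2 ≤ (F u).card := by
    intro u hu
    have hlt : (G₀.neighborFinset u).card < (G.neighborFinset u).card := by
      refine Finset.card_lt_card (Finset.ssubset_iff_of_subset ?_ |>.2 ⟨v, ?_, ?_⟩)
      · intro y hy
        rw [SimpleGraph.mem_neighborFinset] at hy ⊢
        exact ((hadj u y).1 hy).1
      · rw [SimpleGraph.mem_neighborFinset, G.adj_comm, ← SimpleGraph.mem_neighborFinset]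
        exact (Finset.mem_filter.1 hu).1
      · rw [SimpleGraph.mem_neighborFinset, hadj]
        exact fun h => hv h.2.2
    have h₁ := hd u
    rw [← SimpleGraph.card_neighborFinset_eq_degree] at h₁
    have h₂ := Finset.card_image_le (s := G₀.neighborFinset u) (f := fun y => c s(u, y))
    simp only [hF]
    rw [Finset.card_sdiff_of_subset (Finset.subset_univ _), Finset.card_univ, Fintype.card_fin]
    omega
  refine hres.exists_isProperOn ?_ v (fun u hu => (Nat.le_succ 1).trans (hFcard u hu))
    (fun u hu _ => hFcard u hu) ?_
  · rw [Finset.card_univ, Fintype.card_fin]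
    have := hd v
    rw [← SimpleGraph.card_neighborFinset_eq_degree] at this
    exact (Finset.card_filter_le _ _).trans (this.trans (Nat.le_succ d))
  · intro x y hxy
    simp only [SimpleGraph.inf_adj, SimpleGraph.fromRel_adj, Finset.mem_insert] at hxy
    simp only [SimpleGraph.sup_adj, SimpleGraph.fromRel_adj, hadj, hN, Finset.mem_filter,
      SimpleGraph.mem_neighborFinset]
    obtain ⟨hG, hne, hmem⟩ := hxy
    have hG' := hG.symm
    by_cases hx : x = v <;> by_cases hy : y = v
    · exact absurd (hx.trans hy.symm) hne
    · subst hx; tauto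
    · subst hy; tauto
    · tauto

/-! ### Chromatic index and vertex stability -/

theorem chromaticIndex_le_succ [Finite V] (G : SimpleGraph V) (d : ℕ)
    (hd : ∀ x, (G.neighborSet x).ncard ≤ d) : chromaticIndex G ≤ d + 1 := by
  classical
  have := Fintype.ofFinite V
  obtain ⟨c, hc⟩ := exists_isProperOn_of_degree_le G d fun x => by
    rw [← SimpleGraph.card_neighborFinset_eq_degree, ← Set.ncard_coe_finset,
      SimpleGraph.coe_neighborFinset]
    exact hd x
  refine Nat.sInf_le ⟨fun e => c e, ?_⟩
  rintro ⟨e₁, h₁⟩ ⟨e₂, h₂⟩ hne ⟨v, hv₁, hv₂⟩ he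
  obtain ⟨y, rfl⟩ := Sym2.mem_iff_exists.1 hv₁
  obtain ⟨z, rfl⟩ := Sym2.mem_iff_exists.1 hv₂
  exact hne (Subtype.ext (congrArg (fun t => s(v, t)) (hc v y z h₁ h₂ he)))

theorem ncard_neighborSet_le_chromaticIndex [Finite V] (G : SimpleGraph V) (x : V) :
    (G.neighborSet x).ncard ≤ chromaticIndex G := by
  obtain ⟨c, hc⟩ := edgeColorable_chromaticIndex G
  let f : G.neighborSet x → Fin (chromaticIndex G) := fun y => c ⟨s(x, y), y.2⟩
  have hf : Function.Injective f := by
    intro y z h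
    by_contra hne
    refine hc ⟨s(x, y), y.2⟩ ⟨s(x, z), z.2⟩ (fun he => hne ?_)
      ⟨x, Sym2.mem_mk_left _ _, Sym2.mem_mk_left _ _⟩ h
    exact Subtype.ext (Sym2.congr_right.1 (congrArg Subtype.val he))
  simpa using Nat.card_le_card_of_injective f hf

theorem EdgeColorable.of_embedding {W : Type*} {G : SimpleGraph V} {H : SimpleGraph W} {k : ℕ}
    (f : G ↪g H) (h : EdgeColorable H k) : EdgeColorable G k := by
  obtain ⟨c, hc⟩ := h
  refine ⟨fun e => c (f.mapEdgeSet e), fun e₁ e₂ hne hv => hc _ _ (f.mapEdgeSet.injective.ne hne) ?_⟩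
  obtain ⟨v, h₁, h₂⟩ := hv
  exact ⟨f v, Sym2.mem_map.2 ⟨v, h₁, rfl⟩, Sym2.mem_map.2 ⟨v, h₂, rfl⟩⟩

theorem chromaticIndex_eq_of_iso {W : Type*} [Finite V] [Finite W] {G : SimpleGraph V}
    {H : SimpleGraph W} (f : G ≃g H) : chromaticIndex G = chromaticIndex H :=
  congrArg sInf (Set.ext fun _ => ⟨fun h => h.of_embedding f.symm.toEmbedding,
    fun h => h.of_embedding f.toEmbedding⟩)

theorem one_le_vertexStability [Finite V] {G : SimpleGraph V} (hG : G.edgeSet ≠ ∅) :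
    1 ≤ vertexStability G := by
  obtain ⟨S, hS, hne⟩ := exists_card_eq_vertexStability G hG
  refine Nat.one_le_iff_ne_zero.2 fun h0 => hne ?_
  obtain rfl := Finset.card_eq_zero.1 (hS.trans h0)
  have huniv : {v : V | v ∉ (∅ : Finset V)} = Set.univ := by simp
  rw [huniv]
  exact chromaticIndex_eq_of_iso (SimpleGraph.induceUnivIso G)

theorem vertexStability_le_card [Finite V] {G : SimpleGraph V} (S : Finset V)
    (hne : chromaticIndex (G.induce {v : V | v ∉ S}) ≠ chromaticIndex G) :
    vertexStability G ≤ S.card := by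
  unfold vertexStability
  split_ifs
  · exact Nat.zero_le _
  · exact Nat.sInf_le ⟨S, rfl, hne⟩

/-- Deleting a set `S` such that every vertex outside `S` has two neighbours in `S` lowers the
chromatic index: the remaining degrees drop by two, while Vizing's theorem costs only one. -/
theorem chromaticIndex_induce_lt [Finite V] {G : SimpleGraph V} (S : Finset V)
    (hG : G.edgeSet ≠ ∅)
    (hS : ∀ x, x ∉ S → ∃ s ∈ S, ∃ t ∈ S, s ≠ t ∧ G.Adj x s ∧ G.Adj x t) :
    chromaticIndex (G.induce {v : V | v ∉ S}) < chromaticIndex G := by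
  have hpos : 1 ≤ chromaticIndex G := by
    obtain ⟨c, -⟩ := edgeColorable_chromaticIndex G
    obtain ⟨e, he⟩ := Set.nonempty_iff_ne_empty.2 hG
    have := (c ⟨e, he⟩).isLt
    omega
  have key : ∀ x : {v : V | v ∉ S},
      ((G.induce {v : V | v ∉ S}).neighborSet x).ncard + 2 ≤ chromaticIndex G := by
    intro x
    obtain ⟨s, hs, t, ht, hst, has, hat⟩ := hS x x.2
    refine le_trans ?_ (ncard_neighborSet_le_chromaticIndex G x)
    have hcard : ((G.induce {v : V | v ∉ S}).neighborSet x).ncard =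
        (Subtype.val '' (G.induce {v : V | v ∉ S}).neighborSet x).ncard :=
      (Set.ncard_image_of_injective _ Subtype.val_injective).symm
    rw [hcard, ← Set.ncard_pair hst, ← Set.ncard_union_eq ?_ (Set.toFinite _) (Set.toFinite _)]
    · refine Set.ncard_le_ncard ?_ (Set.toFinite _)
      rintro y (⟨y, hy, rfl⟩ | rfl | rfl)
      · exact hy
      · exact has
      · exact hat
    · rw [Set.disjoint_left]
      rintro _ ⟨y, -, rfl⟩ (h | h)
      · exact y.2 (h ▸ hs)
      · exact y.2 (h ▸ ht)
  by_cases h2 : 2 ≤ chromaticIndex G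
  · have := chromaticIndex_le_succ (G.induce {v : V | v ∉ S}) (chromaticIndex G - 2)
      fun x => by have := key x; omega
    omega
  -- otherwise there is no vertex outside `S`
  · have hE : IsEmpty {v : V | v ∉ S} := ⟨fun x => h2 (le_trans (Nat.le_add_left _ _) (key x))⟩
    have : EdgeColorable (G.induce {v : V | v ∉ S}) 0 := by
      have hE' : IsEmpty (G.induce {v : V | v ∉ S}).edgeSet :=
        ⟨fun ⟨e, _⟩ => by induction e with | _ a b => exact hE.elim a⟩
      exact ⟨fun e => hE'.elim e, fun e => hE'.elim e⟩
    exact (Nat.sInf_le this).trans_lt hpos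

end EdgeStability

theorem mainTheorem10 (p : ℕ) (hp : 3 ≤ p) (a : Fin p → ℕ) (ha : ∀ i, 1 ≤ a i) :
    1 ≤ EdgeStability.vertexStability
        (SimpleGraph.completeMultipartiteGraph (fun i : Fin p => Fin (a i))) ∧
      EdgeStability.vertexStability
        (SimpleGraph.completeMultipartiteGraph (fun i : Fin p => Fin (a i))) ≤ 3 := by
  classical
  let r : Fin 3 ↪ Fin p := Fin.castLEEmb hp
  -- the triangle of the first vertices of the first three parts
  let t : Fin 3 → Σ i : Fin p, Fin (a i) := fun m => ⟨r m, ⟨0, ha (r m)⟩⟩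
  have htfst : ∀ m n, (t m).1 = (t n).1 → m = n := fun m n h => r.injective h
  have htinj : Function.Injective t := fun m n h => htfst m n (congrArg Sigma.fst h)
  have hedge : (SimpleGraph.completeMultipartiteGraph fun i : Fin p => Fin (a i)).edgeSet ≠ ∅ := by
    refine Set.nonempty_iff_ne_empty.1 ⟨s(t 0, t 1), ?_⟩
    exact fun h => absurd (htfst 0 1 h) (by decide)
  refine ⟨EdgeStability.one_le_vertexStability hedge, ?_⟩
  have hcard : (Finset.univ.image t).card = 3 := by
    rw [Finset.card_image_of_injective _ htinj, Finset.card_univ, Fintype.card_fin]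
  rw [← hcard]
  refine EdgeStability.vertexStability_le_card _
    (EdgeStability.chromaticIndex_induce_lt _ hedge fun x _ => ?_).ne
  -- at most one of the three chosen vertices lies in the part of `x`
  obtain ⟨m, n, hmn, hm, hn⟩ : ∃ m n : Fin 3, m ≠ n ∧ x.1 ≠ (t m).1 ∧ x.1 ≠ (t n).1 := by
    by_cases h0 : x.1 = (t 0).1
    · refine ⟨1, 2, by decide, fun h => ?_, fun h => ?_⟩
      · exact absurd (htfst 0 1 (h0.symm.trans h)) (by decide)
      · exact absurd (htfst 0 2 (h0.symm.trans h)) (by decide)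
    · by_cases h1 : x.1 = (t 1).1
      · exact ⟨0, 2, by decide, h0,
          fun h => absurd (htfst 1 2 (h1.symm.trans h)) (by decide)⟩
      · exact ⟨0, 1, by decide, h0, h1⟩
  exact ⟨t m, Finset.mem_image_of_mem t (Finset.mem_univ m), t n,
    Finset.mem_image_of_mem t (Finset.mem_univ n), htinj.ne hmn, hm, hn⟩
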